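/- Let $d$ be a natural number and $\alpha>0$ a real number. Let $\psi_0(t)=1/\sqrt2$ and $\psi_m(t)=\sqrt{\tfrac{2m+1}{2}}\,\frac{1}{2^m m!}\,\frac{d^m}{dt^m}\big[(t^2-1)^m\big]$ for $m\ge 1$ (the orthonormal Legendre polynomials of $L_2([-1,1])$), let $$\gamma(t)=\sum_{m=0}^{\lceil\alpha\rceil-1}\psi_m(0)\,\psi_m(t)\,\mathbf 1[-1\le t\le 1]\qquad(t\in\mathbb R),$$ and let $\tilde\kappa(x)=\gamma(x_1)\cdots\gamma(x_d)$ for $x\in\mathbb R^d$. Then the following hold. (K1) $\tilde\kappa$ is integrable with $\int\tilde\kappa(t)\,dt=1$; $\int\|t\|^\alpha|\tilde\kappa(t)|\,dt<\infty$, where $\|\cdot\|$ is the Euclidean norm; and for every non-zero $s=(s_1,\dots,s_d)$ of non-negative integers with $s_1+\cdots+s_d\le\lceil\alpha\rceil-1$, the function $t_1^{s_1}\cdots t_d^{s_d}\,\tilde\kappa(t)$ is integrable and $\int t_1^{s_1}\cdots t_d^{s_d}\,\tilde\kappa(t)\,dt=0$. (K2) $\tilde\kappa$ is square-integrable and bounded,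 and there are constants $\nu,\Lambda>0$, depending only on $d$ and $\alpha$, such that for every set $\mathcal X\subseteq\mathbb R^d$ each of the classes $$\Big\{\tilde\kappa\Big(\frac{\cdot-x}{h}\Big):x\in\mathcal X\Big\}\ \ (h>0\text{ fixed, arbitrary})\qquad\text{and}\qquad\Big\{\tilde\kappa\Big(\frac{\cdot-x}{h}\Big):x\in\mathcal X,\ h>0\Big\}$$ is a uniformly bounded VC-class with dimension $\nu$ and characteristic $\Lambda$. Here a class $\mathcal G$ of Borel functions $\mathbb R^d\to\mathbb R$ is called a uniformly bounded VC-class with dimension $\nu>0$ and characteristic $\Lambda>0$ if $\|\mathcal G\|_\infty:=\sup_{g\in\mathcal G}\sup_{y}|g(y)|<\infty$ and, for every Borel probability measure $P$ on $\mathbb R^d$ and every $\rho\in(0,\|\mathcal G\|_\infty)$, $$N(\mathcal G,L_2(P),\rho)\le\Big(\frac{\Lambda\,\|\mathcal G\|_\infty}{\rho}\Big)^{\nu},$$ where $N(\mathcal G,L_2(P),\rho)$ is the least number of open balls of radius $\rho$ for the $L_2(P)$ distance, with centres in $\mathcal G$, that cover $\mathcal G$. -/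

import Mathlib

open MeasureTheory
open scoped ENNReal

noncomputable section

/-- The orthonormal Legendre polynomials of `L²([-1, 1])`, by Rodrigues' formula:
`ψ_m(t) = √((2m+1)/2) · 1/(2^m m!) · (d/dt)^m (t² - 1)^m`. For `m = 0` this is `√(1/2)`. -/
def legendrePsi (m : ℕ) (t : ℝ) : ℝ :=
  Real.sqrt ((2 * (m : ℝ) + 1) / 2) * (1 / (2 ^ m * (m.factorial : ℝ))) *
    ((Polynomial.derivative^[m])
      (((Polynomial.X : Polynomial ℝ) ^ 2 - 1) ^ m)).eval t

/-- `γ(t) = ∑_{m=0}^{⌈α⌉-1} ψ_m(0) ψ_m(t) 1[-1 ≤ t ≤ 1]`. -/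
def legendreGamma (α : ℝ) (t : ℝ) : ℝ :=
  ∑ m ∈ Finset.range ⌈α⌉₊,
    legendrePsi m 0 * legendrePsi m t * (Set.Icc (-1 : ℝ) 1).indicator (fun _ => (1 : ℝ)) t

/-- The product kernel `x ↦ γ(x₁) ⋯ γ(x_d)` on `ℝ^d`. -/
def legendreKernel (d : ℕ) (α : ℝ) (x : EuclideanSpace ℝ (Fin d)) : ℝ :=
  ∏ i, legendreGamma α (x i)

/-- Condition (K1): unit integral, finite absolute moment of order `α`, and vanishing mixed
moments of every positive total order at most `⌈α⌉ - 1` (written as `< ⌈α⌉`). Finiteness of the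
integrals is stated as integrability. -/
structure SatisfiesK1 {d : ℕ} (α : ℝ) (κ : EuclideanSpace ℝ (Fin d) → ℝ) : Prop where
  integrable : Integrable κ volume
  integral_eq_one : ∫ t, κ t = 1
  integrable_moment : Integrable (fun t => ‖t‖ ^ α * |κ t|) volume
  integrable_mixed : ∀ s : Fin d → ℕ, s ≠ 0 → ∑ i, s i < ⌈α⌉₊ →
    Integrable (fun t => (∏ i, t i ^ s i) * κ t) volume
  integral_mixed_eq_zero : ∀ s : Fin d → ℕ, s ≠ 0 → ∑ i, s i < ⌈α⌉₊ →
    ∫ t, (∏ i, t i ^ s i) * κ t = 0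

/-- `‖G‖_∞ = sup_{g ∈ G} sup_y |g y|`, with values in `[0, ∞]`. -/
def classSupNorm {d : ℕ} (G : Set (EuclideanSpace ℝ (Fin d) → ℝ)) : ℝ≥0∞ :=
  ⨆ g ∈ G, ⨆ y, ‖g y‖ₑ

/-- The covering number `N(G, L₂(P), ρ)`: the least number of open `L₂(P)`-balls of radius `ρ`,
with centres in `G`, that cover `G` (`⊤` if no finite number does). -/
def coveringNumberL2 {d : ℕ} (P : Measure (EuclideanSpace ℝ (Fin d)))
    (G : Set (EuclideanSpace ℝ (Fin d) → ℝ)) (ρ : ℝ) : ℕ∞ :=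
  ⨅ (C : Set (EuclideanSpace ℝ (Fin d) → ℝ)) (_ : C ⊆ G)
    (_ : ∀ g ∈ G, ∃ c ∈ C, eLpNorm (g - c) 2 P < ENNReal.ofReal ρ), C.encard

/-- `G` is a uniformly bounded VC-class (of Borel functions) with dimension `ν` and
characteristic `Λ`. -/
structure IsUniformlyBoundedVCClass {d : ℕ} (G : Set (EuclideanSpace ℝ (Fin d) → ℝ))
    (ν Λ : ℝ) : Prop where
  measurable : ∀ g ∈ G, Measurable g
  dimension_pos : 0 < ν
  characteristic_pos : 0 < Λ
  supNorm_lt_top : classSupNorm G < ⊤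
  covering : ∀ P : Measure (EuclideanSpace ℝ (Fin d)), IsProbabilityMeasure P →
    ∀ ρ : ℝ, 0 < ρ → ρ < (classSupNorm G).toReal →
      (coveringNumberL2 P G ρ : ℝ≥0∞) ≤
        ENNReal.ofReal ((Λ * (classSupNorm G).toReal / ρ) ^ ν)

/-- The class `{κ((· - x) / h) : x ∈ X, h ∈ H}`, for a set `H` of bandwidths. -/
def kernelClass {d : ℕ} (κ : EuclideanSpace ℝ (Fin d) → ℝ)
    (X : Set (EuclideanSpace ℝ (Fin d))) (H : Set ℝ) :
    Set (EuclideanSpace ℝ (Fin d) → ℝ) :=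
  {g | ∃ x ∈ X, ∃ h ∈ H, g = fun y => κ (h⁻¹ • (y - x))}

/-- Condition (K2) for the observation space `X` and the set `H` of bandwidths: `κ` is
square-integrable and bounded, and `{κ((· - x) / h) : x ∈ X, h ∈ H}` is a uniformly bounded
VC-class with dimension `ν` and characteristic `Λ`. -/
structure SatisfiesK2 {d : ℕ} (κ : EuclideanSpace ℝ (Fin d) → ℝ)
    (X : Set (EuclideanSpace ℝ (Fin d))) (H : Set ℝ) (ν Λ : ℝ) : Prop where
  memLp_two : MemLp κ 2 volume
  bounded : ∃ M : ℝ, ∀ x, |κ x| ≤ M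
  vcClass : IsUniformlyBoundedVCClass (kernelClass κ X H) ν Λ

end

/-! Put `N = ⌈α⌉₊`. On `[-1, 1]` the function `γ` is the reproducing kernel at `0` of the
polynomials of degree `< N`, so `∫ q γ = q(0)` for every such `q`
(`integral_legendreReproducingPoly_mul`). Monomials give the one-dimensional moments, Fubini the
mixed ones, and compact support the moment of order `α`.

For (K2), the subgraph condition `s ≤ κ((y - x) / h)` is a Boolean combination of `d + 1`
inequalities `0 ≤ F`, each `F` a finite sum of products of a function of `(y, s)` and a function of
`(x, h)`. Each inequality is a half-space condition, so Sauer–Shelah bounds the traces on `n` points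
polynomially (`hasPolynomialGrowth_nonneg_sum`). Given `n` functions that are `ρ`-separated in
`L²(P)`, about `log n / r²` points, with `r = ρ / M` and `M` the sup norm, separate them all
pointwise. A grid of levels turns this into `n` distinct traces, whence `n ≤ (Λ / r) ^ ν`
(`card_le_of_pairwise_eLpNorm`, `le_pow_of_forall_pow_mul_sq_lt_one`). A maximal separated family is
a cover. -/

section Legendre

open Polynomial

/-! ### Orthonormality of the Legendre polynomials. -/

lemma integral_eval_derivative_mul (p q : ℝ[X]) (h1 : p.eval 1 = 0) (h2 : p.eval (-1) = 0) :
    ∫ t in (-1 : ℝ)..1, (derivative p).eval t * q.eval t =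
      -∫ t in (-1 : ℝ)..1, p.eval t * (derivative q).eval t := by
  have h := intervalIntegral.integral_deriv_mul_eq_sub (a := (-1 : ℝ)) (b := 1)
    (u := fun t => p.eval t) (v := fun t => q.eval t)
    (u' := fun t => (derivative p).eval t) (v' := fun t => (derivative q).eval t)
    (fun t _ => p.hasDerivAt t) (fun t _ => q.hasDerivAt t)
    ((derivative p).continuous.intervalIntegrable _ _)
    ((derivative q).continuous.intervalIntegrable _ _)
  rw [intervalIntegral.integral_add (Continuous.intervalIntegrable (by fun_prop) _ _)
    (Continuous.intervalIntegrable (by fun_prop) _ _)] at h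
  simp only [h1, h2] at h
  linarith

/-- The polynomial `(X² - 1)^m` of Rodrigues' formula. -/
noncomputable def rodriguesPoly (m : ℕ) : ℝ[X] := (X ^ 2 - 1) ^ m

/-- Each derivative removes at most one factor `X² - 1`. This kills the boundary terms in the
integrations by parts. -/
lemma eval_iterate_derivative_rodriguesPoly {m j : ℕ} (hj : j < m) {t : ℝ} (ht : t ^ 2 = 1) :
    (derivative^[j] (rodriguesPoly m)).eval t = 0 := by
  have h : (X ^ 2 - 1 : ℝ[X]) ∣ derivative^[j] (rodriguesPoly m) :=
    (dvd_pow_self _ (by omega)).trans (pow_sub_dvd_iterate_derivative_pow _ m j)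
  obtain ⟨c, hc⟩ := h
  rw [hc]
  simp [ht]

lemma integral_iterate_derivative_rodriguesPoly_mul (m : ℕ) {j : ℕ} (hj : j ≤ m) (q : ℝ[X]) :
    ∫ t in (-1 : ℝ)..1, (derivative^[j] (rodriguesPoly m)).eval t * q.eval t =
      (-1) ^ j * ∫ t in (-1 : ℝ)..1,
        (rodriguesPoly m).eval t * (derivative^[j] q).eval t := by
  induction j generalizing q with
  | zero => simp
  | succ j ih =>
    rw [Function.iterate_succ_apply', integral_eval_derivative_mul _ _
      (eval_iterate_derivative_rodriguesPoly (by omega) (by norm_num))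
      (eval_iterate_derivative_rodriguesPoly (by omega) (by norm_num)), ih (by omega),
      Function.iterate_succ_apply, pow_succ]
    ring

lemma monic_rodriguesPoly (m : ℕ) : (rodriguesPoly m).Monic :=
  Monic.pow (by monicity!) m

lemma natDegree_rodriguesPoly (m : ℕ) : (rodriguesPoly m).natDegree = 2 * m := by
  rw [rodriguesPoly, natDegree_pow]
  have : (X ^ 2 - 1 : ℝ[X]).natDegree = 2 := by compute_degree!
  rw [this, mul_comm]

lemma iterate_derivative_two_mul_rodriguesPoly (m : ℕ) :
    derivative^[2 * m] (rodriguesPoly m) = C ((2 * m).factorial : ℝ) := by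
  ext k
  rw [coeff_iterate_derivative, coeff_C]
  split_ifs with hk
  · subst hk
    have h := (monic_rodriguesPoly m).coeff_natDegree
    rw [natDegree_rodriguesPoly] at h
    simp [h, Nat.descFactorial_self]
  · rw [coeff_eq_zero_of_natDegree_lt, smul_zero]
    rw [natDegree_rodriguesPoly]
    omega

/-- Integrate the derivative of `t (1 - t²)^(m+1)`, which vanishes at `±1`. -/
lemma integral_one_sub_sq_pow_succ (m : ℕ) :
    (2 * m + 3 : ℝ) * ∫ t in (-1 : ℝ)..1, (1 - t ^ 2) ^ (m + 1) =
      (2 * m + 2) * ∫ t in (-1 : ℝ)..1, (1 - t ^ 2) ^ m := by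
  have hd : ∀ t : ℝ, HasDerivAt (fun t : ℝ => t * (1 - t ^ 2) ^ (m + 1))
      ((2 * m + 3) * (1 - t ^ 2) ^ (m + 1) - (2 * m + 2) * (1 - t ^ 2) ^ m) t := by
    intro t
    have h := (hasDerivAt_id t).mul ((((hasDerivAt_id t).pow 2).const_sub 1).pow (m + 1))
    refine h.congr_deriv ?_
    simp
    ring
  have h := intervalIntegral.integral_eq_sub_of_hasDerivAt (a := (-1 : ℝ)) (b := 1)
    (fun t _ => hd t) (Continuous.intervalIntegrable (by fun_prop) _ _)
  rw [intervalIntegral.integral_sub (Continuous.intervalIntegrable (by fun_prop) _ _)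
    (Continuous.intervalIntegrable (by fun_prop) _ _), intervalIntegral.integral_const_mul,
    intervalIntegral.integral_const_mul] at h
  norm_num at h
  linarith

lemma integral_one_sub_sq_pow (m : ℕ) :
    ((2 * m + 1).factorial : ℝ) * ∫ t in (-1 : ℝ)..1, (1 - t ^ 2) ^ m =
      2 * (2 ^ m * m.factorial) ^ 2 := by
  induction m with
  | zero => norm_num
  | succ m ih =>
    have h := integral_one_sub_sq_pow_succ m
    have e : ((2 * (m + 1) + 1).factorial : ℝ) =
        (2 * m + 3) * (2 * m + 2) * (2 * m + 1).factorial := by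
      rw [show 2 * (m + 1) + 1 = 2 * m + 1 + 1 + 1 by ring, Nat.factorial_succ, Nat.factorial_succ]
      push_cast
      ring
    rw [e, Nat.factorial_succ m]
    push_cast
    linear_combination ((2 * m + 2) * (2 * m + 1).factorial : ℝ) * h + (2 * m + 2) ^ 2 * ih

/-- The orthonormal Legendre polynomial as an element of `ℝ[X]`. -/
noncomputable def legendrePoly (m : ℕ) : ℝ[X] :=
  C (Real.sqrt ((2 * (m : ℝ) + 1) / 2) * (1 / (2 ^ m * (m.factorial : ℝ)))) *
    derivative^[m] (rodriguesPoly m)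

lemma legendrePsi_eq_eval (m : ℕ) (t : ℝ) : legendrePsi m t = (legendrePoly m).eval t := by
  simp [legendrePsi, legendrePoly, rodriguesPoly]

lemma coeff_legendrePoly_self_ne_zero (m : ℕ) : (legendrePoly m).coeff m ≠ 0 := by
  have h := (monic_rodriguesPoly m).coeff_natDegree
  rw [natDegree_rodriguesPoly] at h
  rw [legendrePoly, coeff_C_mul, coeff_iterate_derivative, ← two_mul, h]
  have : ((2 * m).descFactorial m : ℝ) ≠ 0 := by
    exact_mod_cast (Nat.descFactorial_pos.2 (by omega)).ne'
  have h2 : Real.sqrt ((2 * (m : ℝ) + 1) / 2) ≠ 0 := (Real.sqrt_pos.2 (by positivity)).ne'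
  simp only [nsmul_eq_mul, mul_one]
  positivity

lemma natDegree_legendrePoly_le (m : ℕ) : (legendrePoly m).natDegree ≤ m := by
  refine (natDegree_C_mul_le _ _).trans ((natDegree_iterate_derivative _ _).trans ?_)
  rw [natDegree_rodriguesPoly]
  omega

lemma integral_legendrePoly_mul_of_degree_lt {m : ℕ} {q : ℝ[X]} (hq : q.natDegree < m) :
    ∫ t in (-1 : ℝ)..1, (legendrePoly m).eval t * q.eval t = 0 := by
  simp only [legendrePoly, eval_mul, eval_C, mul_assoc]
  rw [intervalIntegral.integral_const_mul, intervalIntegral.integral_const_mul,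
    integral_iterate_derivative_rodriguesPoly_mul m le_rfl, iterate_derivative_eq_zero hq]
  simp

/-- Moving `m` derivatives across leaves the constant `(2m)!` against `(t² - 1)^m`; the two signs
`(-1)^m` cancel, and the integral of `(1 - t²)^m` is known. -/
lemma integral_legendrePoly_sq (m : ℕ) :
    ∫ t in (-1 : ℝ)..1, (legendrePoly m).eval t * (legendrePoly m).eval t = 1 := by
  set c := Real.sqrt ((2 * (m : ℝ) + 1) / 2) * (1 / (2 ^ m * (m.factorial : ℝ))) with hc
  have h1 : ∀ t : ℝ, (legendrePoly m).eval t * (legendrePoly m).eval t = c ^ 2 *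
      ((derivative^[m] (rodriguesPoly m)).eval t * (derivative^[m] (rodriguesPoly m)).eval t) := by
    intro t
    simp only [legendrePoly, ← hc, eval_mul, eval_C]
    ring
  have h2 : ∀ t : ℝ, (rodriguesPoly m).eval t *
      (derivative^[m] (derivative^[m] (rodriguesPoly m))).eval t =
      ((-1) ^ m * (2 * m).factorial) * (1 - t ^ 2) ^ m := by
    intro t
    rw [← Function.iterate_add_apply, ← two_mul, iterate_derivative_two_mul_rodriguesPoly,
      rodriguesPoly, eval_C, eval_pow, eval_sub, eval_pow, eval_X, eval_one,
      show t ^ 2 - 1 = (-1) * (1 - t ^ 2) by ring, mul_pow]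
    ring
  simp only [h1]
  rw [intervalIntegral.integral_const_mul, integral_iterate_derivative_rodriguesPoly_mul m le_rfl]
  simp only [h2]
  rw [intervalIntegral.integral_const_mul]
  have h3 := integral_one_sub_sq_pow m
  rw [Nat.factorial_succ] at h3
  push_cast at h3
  set I := ∫ t in (-1 : ℝ)..1, (1 - t ^ 2) ^ m
  have h4 : c ^ 2 * (2 * (2 ^ m * m.factorial) ^ 2) = 2 * m + 1 := by
    rw [hc, mul_pow, Real.sq_sqrt (by positivity)]
    field_simp
  have h5 : ((-1 : ℝ) ^ m) * (-1) ^ m = 1 := by rw [← mul_pow]; norm_num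
  rw [← h3] at h4
  have h6 : (2 * (m : ℝ) + 1) ≠ 0 := by positivity
  apply mul_left_cancel₀ h6
  linear_combination h4 + (2 * m + 1) * c ^ 2 * (2 * m).factorial * I * h5

lemma integral_legendrePoly_mul_legendrePoly (m n : ℕ) :
    ∫ t in (-1 : ℝ)..1, (legendrePoly m).eval t * (legendrePoly n).eval t =
      if m = n then 1 else 0 := by
  split_ifs with h
  · rw [h, integral_legendrePoly_sq]
  · rcases lt_or_gt_of_ne h with h | h
    · simp only [mul_comm ((legendrePoly m).eval _)]
      exact integral_legendrePoly_mul_of_degree_lt ((natDegree_legendrePoly_le m).trans_lt h)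
    · exact integral_legendrePoly_mul_of_degree_lt ((natDegree_legendrePoly_le n).trans_lt h)

/-! ### The reproducing property at the origin. -/

/-- `legendrePoly N` has exact degree `N`, so subtracting a multiple of it removes the top
coefficient. -/
lemma exists_eq_sum_legendrePoly (N : ℕ) (q : ℝ[X]) (hq : q.degree < N) :
    ∃ a : ℕ → ℝ, q = ∑ m ∈ Finset.range N, C (a m) * legendrePoly m := by
  induction N generalizing q with
  | zero => exact ⟨0, by simpa using hq⟩
  | succ N ih =>
    set c := q.coeff N / (legendrePoly N).coeff N with hc
    obtain ⟨a, ha⟩ := ih (q - C c * legendrePoly N) (by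
      rw [degree_lt_iff_coeff_zero] at hq ⊢
      intro k hk
      rw [coeff_sub, coeff_C_mul]
      rcases hk.eq_or_lt with rfl | hk
      · rw [hc, div_mul_cancel₀ _ (coeff_legendrePoly_self_ne_zero _), sub_self]
      · rw [hq k hk, coeff_eq_zero_of_natDegree_lt ((natDegree_legendrePoly_le N).trans_lt hk)]
        simp)
    refine ⟨Function.update a N c, ?_⟩
    rw [Finset.sum_range_succ, Function.update_self, Finset.sum_congr rfl
      (g := fun m => C (a m) * legendrePoly m), ← ha]
    · ring
    · intro m hm
      rw [Function.update_of_ne (Finset.mem_range.1 hm).ne]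

/-- The reproducing kernel at `0` of the polynomials of degree `< N` in `L²([-1, 1])`. -/
noncomputable def legendreReproducingPoly (N : ℕ) : ℝ[X] :=
  ∑ m ∈ Finset.range N, C ((legendrePoly m).eval 0) * legendrePoly m

/-- If `q = ∑ aᵢ ψᵢ`, orthonormality reduces the integral to `∑ aᵢ ψᵢ(0)`. -/
lemma integral_legendreReproducingPoly_mul {N : ℕ} {q : ℝ[X]} (hq : q.degree < N) :
    ∫ t in (-1 : ℝ)..1, q.eval t * (legendreReproducingPoly N).eval t = q.eval 0 := by
  obtain ⟨a, rfl⟩ := exists_eq_sum_legendrePoly N q hq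
  simp only [legendreReproducingPoly, eval_finsetSum, eval_mul, eval_C, Finset.sum_mul_sum]
  rw [intervalIntegral.integral_finsetSum
    (fun i _ => Continuous.intervalIntegrable (by fun_prop) _ _)]
  refine Finset.sum_congr rfl fun i hi => ?_
  rw [intervalIntegral.integral_finsetSum
    (fun i _ => Continuous.intervalIntegrable (by fun_prop) _ _)]
  have h : ∀ (j : ℕ) (t : ℝ),
      a i * (legendrePoly i).eval t * ((legendrePoly j).eval 0 * (legendrePoly j).eval t) =
        a i * (legendrePoly j).eval 0 * ((legendrePoly i).eval t * (legendrePoly j).eval t) :=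
    fun j t => by ring
  simp only [h, intervalIntegral.integral_const_mul, integral_legendrePoly_mul_legendrePoly]
  simp [Finset.mem_range.1 hi]

lemma legendreGamma_eq_indicator (α t : ℝ) : legendreGamma α t =
    (Set.Icc (-1 : ℝ) 1).indicator (fun t => (legendreReproducingPoly ⌈α⌉₊).eval t) t := by
  simp only [legendreGamma, legendreReproducingPoly, legendrePsi_eq_eval, Set.indicator_apply,
    eval_finsetSum, eval_mul, eval_C]
  split_ifs <;> simp

end Legendre

/-! ### Moments, boundedness and support of the product kernel. -/

section KernelMoments

open Polynomial

lemma measurable_legendreGamma (α : ℝ) : Measurable (legendreGamma α) := by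
  rw [funext (legendreGamma_eq_indicator α)]
  exact (Polynomial.continuous _).measurable.indicator measurableSet_Icc

lemma pow_mul_legendreGamma (α : ℝ) (s : ℕ) (t : ℝ) : t ^ s * legendreGamma α t =
    (Set.Icc (-1 : ℝ) 1).indicator (fun t => t ^ s * (legendreReproducingPoly ⌈α⌉₊).eval t) t := by
  rw [legendreGamma_eq_indicator, Set.indicator_mul_right]

lemma integrable_pow_mul_legendreGamma (α : ℝ) (s : ℕ) :
    Integrable (fun t : ℝ => t ^ s * legendreGamma α t) := by
  simp only [pow_mul_legendreGamma]
  rw [integrable_indicator_iff measurableSet_Icc]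
  exact ContinuousOn.integrableOn_Icc (by fun_prop)

lemma integral_pow_mul_legendreGamma {α : ℝ} {s : ℕ} (hs : s < ⌈α⌉₊) :
    ∫ t : ℝ, t ^ s * legendreGamma α t = if s = 0 then 1 else 0 := by
  simp only [pow_mul_legendreGamma]
  rw [integral_indicator measurableSet_Icc, integral_Icc_eq_integral_Ioc,
    ← intervalIntegral.integral_of_le (by norm_num)]
  have h := integral_legendreReproducingPoly_mul (N := ⌈α⌉₊) (q := X ^ s)
    (by rw [degree_X_pow]; exact_mod_cast hs)
  simp only [eval_pow, eval_X] at h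
  rw [h, zero_pow_eq]

lemma exists_abs_legendreGamma_le (α : ℝ) : ∃ M : ℝ, 0 ≤ M ∧ ∀ t, |legendreGamma α t| ≤ M := by
  obtain ⟨M, hM⟩ := isCompact_Icc.exists_bound_of_continuousOn (s := Set.Icc (-1 : ℝ) 1)
    (f := fun t => (legendreReproducingPoly ⌈α⌉₊).eval t) (by fun_prop)
  have h0 : 0 ≤ M := (norm_nonneg _).trans (hM 0 (by norm_num))
  refine ⟨M, h0, fun t => ?_⟩
  rw [legendreGamma_eq_indicator, Set.indicator_apply]
  split_ifs with ht
  · exact hM t ht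
  · simpa using h0

variable {d : ℕ} (α : ℝ)

lemma measurable_legendreKernel : Measurable (legendreKernel d α) := by
  unfold legendreKernel
  have := measurable_legendreGamma α
  fun_prop

lemma exists_abs_legendreKernel_le :
    ∃ M : ℝ, ∀ x : EuclideanSpace ℝ (Fin d), |legendreKernel d α x| ≤ M := by
  obtain ⟨M, h0, hM⟩ := exists_abs_legendreGamma_le α
  refine ⟨M ^ d, fun x => ?_⟩
  rw [legendreKernel, Finset.abs_prod]
  exact (Finset.prod_le_prod (fun _ _ => abs_nonneg _) fun i _ => hM (x i)).trans_eq (by simp)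

lemma prod_pow_mul_legendreKernel (s : Fin d → ℕ) (t : EuclideanSpace ℝ (Fin d)) :
    (∏ i, t i ^ s i) * legendreKernel d α t = ∏ i, (t i ^ s i * legendreGamma α (t i)) := by
  rw [legendreKernel, Finset.prod_mul_distrib]

lemma integrable_prod_pow_mul_legendreKernel (s : Fin d → ℕ) :
    Integrable (fun t : EuclideanSpace ℝ (Fin d) => (∏ i, t i ^ s i) * legendreKernel d α t) := by
  simp only [prod_pow_mul_legendreKernel]
  have h : Integrable (fun t : Fin d → ℝ => ∏ i, (t i ^ s i * legendreGamma α (t i))) :=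
    Integrable.fintype_prod (f := fun i (v : ℝ) => v ^ s i * legendreGamma α v)
      (fun i => integrable_pow_mul_legendreGamma α (s i))
  exact (PiLp.volume_preserving_ofLp (Fin d)).integrable_comp_of_integrable h

lemma integral_prod_pow_mul_legendreKernel {s : Fin d → ℕ} (hs : ∀ i, s i < ⌈α⌉₊) :
    ∫ t : EuclideanSpace ℝ (Fin d), (∏ i, t i ^ s i) * legendreKernel d α t =
      if s = 0 then 1 else 0 := by
  simp only [prod_pow_mul_legendreKernel]
  have h := (PiLp.volume_preserving_ofLp (Fin d)).integral_comp
    (MeasurableEquiv.toLp 2 (Fin d → ℝ)).symm.measurableEmbedding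
    (fun t : Fin d → ℝ => ∏ i, (t i ^ s i * legendreGamma α (t i)))
  rw [h, integral_fintype_prod_volume_eq_prod (fun i (v : ℝ) => v ^ s i * legendreGamma α v)]
  simp only [integral_pow_mul_legendreGamma (hs _), Finset.prod_ite_zero]
  simp [funext_iff]

lemma legendreKernel_eq_zero_of_lt_norm {t : EuclideanSpace ℝ (Fin d)}
    (ht : Real.sqrt d < ‖t‖) : legendreKernel d α t = 0 := by
  by_contra h
  refine absurd ht (not_lt.2 ?_)
  rw [EuclideanSpace.norm_eq]
  refine Real.sqrt_le_sqrt ((Finset.sum_le_card_nsmul _ _ 1 fun i _ => ?_).trans_eq (by simp))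
  have hi := Finset.prod_ne_zero_iff.1 h i (Finset.mem_univ i)
  rw [legendreGamma_eq_indicator] at hi
  have := Set.mem_of_indicator_ne_zero hi
  rw [Real.norm_eq_abs, sq_abs, sq_le_one_iff_abs_le_one]
  exact abs_le.2 this

lemma integrable_legendreKernel : Integrable (legendreKernel d α) := by
  simpa using integrable_prod_pow_mul_legendreKernel α (0 : Fin d → ℕ)

lemma memLp_two_legendreKernel : MemLp (legendreKernel d α) 2 volume := by
  obtain ⟨M, hM⟩ := exists_abs_legendreKernel_le (d := d) α
  rw [memLp_two_iff_integrable_sq (measurable_legendreKernel α).aestronglyMeasurable]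
  simp only [sq]
  exact (integrable_legendreKernel α).bdd_mul (measurable_legendreKernel α).aestronglyMeasurable
    (Filter.Eventually.of_forall hM)

lemma satisfiesK1_legendreKernel {α : ℝ} (hα : 0 < α) : SatisfiesK1 α (legendreKernel d α) where
  integrable := integrable_legendreKernel α
  integral_eq_one := by
    have h := integral_prod_pow_mul_legendreKernel (d := d) α (s := 0)
      (fun i => Nat.ceil_pos.2 hα)
    simpa using h
  integrable_moment := by
    -- The kernel vanishes outside the ball of radius `√d`, so `√d ^ α * |κ|` is a dominating
    -- function.
    refine ((integrable_legendreKernel α).abs.const_mul (Real.sqrt d ^ α)).mono'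
      (Measurable.aestronglyMeasurable ?_) (Filter.Eventually.of_forall fun t => ?_)
    · have := measurable_legendreKernel (d := d) α
      fun_prop
    · rw [Real.norm_of_nonneg (by positivity)]
      rcases lt_or_ge (Real.sqrt d) ‖t‖ with ht | ht
      · simp [legendreKernel_eq_zero_of_lt_norm α ht]
      · gcongr
  integrable_mixed s _ _ := integrable_prod_pow_mul_legendreKernel α s
  integral_mixed_eq_zero s hs hs' := by
    -- Each `s i` is at most the total order, so every one-dimensional moment is in the reproducing
    -- range.
    rw [integral_prod_pow_mul_legendreKernel α fun i =>
      (Finset.single_le_sum (fun _ _ => Nat.zero_le _) (Finset.mem_univ i)).trans_lt hs',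
      if_neg hs]

end KernelMoments

/-! ### Counting traces: half-spaces and Boolean combinations. -/

section Growth

open scoped Classical in
/-- The traces on the finite set `T` of the sets `{t | R t p}`, for a parameter `p`. -/
noncomputable def tracePatterns {τ Θ : Type*} (R : τ → Θ → Prop) (T : Finset τ) :
    Finset (Finset τ) :=
  T.powerset.filter fun S => ∃ p, S = T.filter fun t => R t p

/-- The number of traces on `n` points is at most `(n + 1) ^ E`. -/
def HasPolynomialGrowth {τ Θ : Type*} (R : τ → Θ → Prop) (E : ℕ) : Prop :=
  ∀ T : Finset τ, (tracePatterns R T).card ≤ (T.card + 1) ^ E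

variable {τ Θ : Type*}

open scoped Classical in
lemma mem_tracePatterns {R : τ → Θ → Prop} {T S : Finset τ} :
    S ∈ tracePatterns R T ↔ ∃ p, S = T.filter fun t => R t p := by
  simp only [tracePatterns, Finset.mem_filter, Finset.mem_powerset, and_iff_right_iff_imp]
  rintro ⟨p, rfl⟩
  exact Finset.filter_subset _ _

lemma HasPolynomialGrowth.comap {Θ' : Type*} {R : τ → Θ → Prop} {R' : τ → Θ' → Prop} {E : ℕ}
    (h : HasPolynomialGrowth R' E) (hR : ∀ p, ∃ p', ∀ t, R t p ↔ R' t p') :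
    HasPolynomialGrowth R E := by
  classical
  refine fun T => (Finset.card_le_card fun S hS => ?_).trans (h T)
  obtain ⟨p, rfl⟩ := mem_tracePatterns.1 hS
  obtain ⟨p', hp'⟩ := hR p
  exact mem_tracePatterns.2 ⟨p', by simp only [hp']⟩

/-- The trace of `R` is determined by the traces of the `Q j`, because `Φ` sees the parameter only
through them; the counts multiply. -/
lemma HasPolynomialGrowth.of_forall_iff {ι : Type*} [Fintype ι] {R : τ → Θ → Prop}
    {Q : ι → τ → Θ → Prop} {E : ι → ℕ} (h : ∀ j, HasPolynomialGrowth (Q j) (E j))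
    (Φ : τ → (ι → Prop) → Prop) (hR : ∀ t p, R t p ↔ Φ t fun j => Q j t p) :
    HasPolynomialGrowth R (∑ j, E j) := by
  classical
  intro T
  have hsub : tracePatterns R T ⊆ (Fintype.piFinset fun j => tracePatterns (Q j) T).image
      fun S => T.filter fun t => Φ t fun j => t ∈ S j := by
    intro S hS
    obtain ⟨p, rfl⟩ := mem_tracePatterns.1 hS
    refine Finset.mem_image.2 ⟨fun j => T.filter fun t => Q j t p,
      Fintype.mem_piFinset.2 fun j => mem_tracePatterns.2 ⟨p, rfl⟩, ?_⟩
    refine Finset.filter_congr fun t ht => ?_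
    simp only [Finset.mem_filter, ht, true_and, hR]
  calc (tracePatterns R T).card
      ≤ (Fintype.piFinset fun j => tracePatterns (Q j) T).card :=
        (Finset.card_le_card hsub).trans Finset.card_image_le
    _ = ∏ j, (tracePatterns (Q j) T).card := Fintype.card_piFinset _
    _ ≤ ∏ j, (T.card + 1) ^ E j := Finset.prod_le_prod' fun j _ => h j T
    _ = (T.card + 1) ^ ∑ j, E j := Finset.prod_pow_eq_pow_sum _ _ _

/-- Use `choose n k ≤ n ^ k * choose D k` for `k ≤ D` and the binomial theorem. -/
lemma card_powerset_filter_card_le (T : Finset τ) (D : ℕ) :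
    (T.powerset.filter fun S => S.card ≤ D).card ≤ (T.card + 1) ^ D := by
  classical
  have hsub : (T.powerset.filter fun S => S.card ≤ D) ⊆
      (Finset.range (D + 1)).biUnion fun k => T.powersetCard k := by
    intro S hS
    rw [Finset.mem_filter, Finset.mem_powerset] at hS
    exact Finset.mem_biUnion.2 ⟨S.card, Finset.mem_range.2 (by omega),
      Finset.mem_powersetCard.2 ⟨hS.1, rfl⟩⟩
  calc _ ≤ ∑ k ∈ Finset.range (D + 1), (T.powersetCard k).card :=
        (Finset.card_le_card hsub).trans Finset.card_biUnion_le
    _ ≤ ∑ k ∈ Finset.range (D + 1), T.card ^ k * 1 ^ (D - k) * D.choose k := by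
        refine Finset.sum_le_sum fun k hk => ?_
        rw [Finset.card_powersetCard, one_pow, mul_one]
        exact (Nat.choose_le_pow _ _).trans (Nat.le_mul_of_pos_right _
          (Nat.choose_pos (Nat.lt_succ_iff.1 (Finset.mem_range.1 hk))))
    _ = (T.card + 1) ^ D := (add_pow _ _ _).symm

/-- The sets where a linear functional of `ι → ℝ` is non-negative shatter at most
`Fintype.card ι` points, so they have polynomial growth by the Sauer–Shelah lemma. -/
lemma hasPolynomialGrowth_nonneg_sum {ι : Type*} [Fintype ι] (u : τ → ι → ℝ) (v : Θ → ι → ℝ) :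
    HasPolynomialGrowth (fun t p => 0 ≤ ∑ i, u t i * v p i) (Fintype.card ι) := by
  classical
  intro T
  refine (Finset.card_le_card_shatterer _).trans
    ((Finset.card_le_card fun S hS => ?_).trans (card_powerset_filter_card_le T _))
  rw [Finset.mem_shatterer] at hS
  have hST : S ⊆ T := by
    obtain ⟨U, hU, hSU⟩ := hS.exists_superset
    obtain ⟨p, rfl⟩ := mem_tracePatterns.1 hU
    exact hSU.trans (Finset.filter_subset _ _)
  refine Finset.mem_filter.2 ⟨Finset.mem_powerset.2 hST, ?_⟩
  by_contra hcard
  have hdep : ¬ LinearIndependent ℝ fun t : S => u t := by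
    intro hli
    have := hli.fintype_card_le_finrank
    simp only [Fintype.card_coe, Module.finrank_fintype_fun_eq_card] at this
    exact hcard this
  obtain ⟨g, hg, t₁, ht₁⟩ := Fintype.not_linearIndependent_iff.1 hdep
  -- Change the sign of the linear relation if necessary, so that some coefficient is negative.
  obtain ⟨c, hc, t₀, ht₀⟩ : ∃ c : S → ℝ, ∑ t, c t • u t = 0 ∧ ∃ t, c t < 0 := by
    rcases lt_or_gt_of_ne ht₁ with h | h
    · exact ⟨g, hg, t₁, h⟩
    · exact ⟨fun t => -g t, by simp only [neg_smul, Finset.sum_neg_distrib, hg, neg_zero], t₁,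
        by simpa using h⟩
  -- Shattering yields a parameter whose functional is non-negative exactly where `c` is. All terms
  -- of the vanishing sum `hsum` are then non-negative, and the one at `t₀` is positive.
  obtain ⟨U, hU, hSU⟩ := hS (t := S.attach.filter (fun t => 0 ≤ c t) |>.image Subtype.val)
    (by
      intro x hx
      obtain ⟨t, -, rfl⟩ := Finset.mem_image.1 hx
      exact t.2)
  obtain ⟨p, rfl⟩ := mem_tracePatterns.1 hU
  have hiff : ∀ t : S, 0 ≤ ∑ i, u t i * v p i ↔ 0 ≤ c t := by
    intro t
    have h := Finset.ext_iff.1 hSU t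
    simpa [hST t.2] using h
  have hsum : ∑ t, c t * ∑ i, u t i * v p i = 0 := by
    simp only [Finset.mul_sum]
    rw [Finset.sum_comm]
    refine Finset.sum_eq_zero fun i _ => ?_
    have h := congrFun hc i
    simp only [Finset.sum_apply, Pi.smul_apply, smul_eq_mul, Pi.zero_apply] at h
    simp only [← mul_assoc, ← Finset.sum_mul, h, zero_mul]
  refine hsum.not_gt (Finset.sum_pos' (fun t _ => ?_) ⟨t₀, Finset.mem_univ _, ?_⟩)
  · rcases lt_or_ge (c t) 0 with h | h
    · exact (mul_pos_of_neg_of_neg h (not_le.1 fun h' => h.not_ge ((hiff t).1 h'))).le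
    · exact mul_nonneg h ((hiff t).2 h)
  · exact mul_pos_of_neg_of_neg ht₀ (not_le.1 fun h' => ht₀.not_ge ((hiff t₀).1 h'))

variable (τ Θ) in
/-- The functions of two variables that are finite sums of products of a function of the first
variable and a function of the second. -/
def finiteRankSubalgebra : Subalgebra ℝ (τ → Θ → ℝ) where
  carrier := {F | ∃ (ι : Type) (_ : Fintype ι) (u : τ → ι → ℝ) (v : Θ → ι → ℝ),
    ∀ t p, F t p = ∑ i, u t i * v p i}
  mul_mem' := by
    rintro F G ⟨ι, _, u, v, hF⟩ ⟨κ, _, u', v', hG⟩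
    refine ⟨ι × κ, inferInstance, fun t i => u t i.1 * u' t i.2, fun p i => v p i.1 * v' p i.2,
      fun t p => ?_⟩
    rw [Pi.mul_apply, Pi.mul_apply, hF, hG, Finset.sum_mul_sum, Fintype.sum_prod_type]
    exact Finset.sum_congr rfl fun i _ => Finset.sum_congr rfl fun j _ => by ring
  add_mem' := by
    rintro F G ⟨ι, _, u, v, hF⟩ ⟨κ, _, u', v', hG⟩
    refine ⟨ι ⊕ κ, inferInstance, fun t => Sum.elim (u t) (u' t),
      fun p => Sum.elim (v p) (v' p), fun t p => ?_⟩
    simp [hF, hG]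
  algebraMap_mem' r := ⟨Unit, inferInstance, fun _ _ => r, fun _ _ => 1, fun t p => by
    simp [Pi.algebraMap_apply]⟩

lemma left_mem_finiteRankSubalgebra (f : τ → ℝ) :
    (fun t _ => f t) ∈ finiteRankSubalgebra τ Θ :=
  ⟨Unit, inferInstance, fun t _ => f t, fun _ _ => 1, fun t p => by simp⟩

lemma right_mem_finiteRankSubalgebra (f : Θ → ℝ) :
    (fun _ p => f p) ∈ finiteRankSubalgebra τ Θ :=
  ⟨Unit, inferInstance, fun _ _ => 1, fun p _ => f p, fun t p => by simp⟩

lemma polynomial_eval_mem_finiteRankSubalgebra {F : τ → Θ → ℝ}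
    (hF : F ∈ finiteRankSubalgebra τ Θ) (q : Polynomial ℝ) :
    (fun t p => q.eval (F t p)) ∈ finiteRankSubalgebra τ Θ := by
  have h : (fun t p => q.eval (F t p)) =
      ∑ k ∈ Finset.range (q.natDegree + 1), q.coeff k • F ^ k := by
    ext t p
    simp [Polynomial.eval_eq_sum_range]
  rw [h]
  exact sum_mem fun k _ => Subalgebra.smul_mem _ (pow_mem hF k) _

lemma exists_hasPolynomialGrowth_nonneg {F : τ → Θ → ℝ} (hF : F ∈ finiteRankSubalgebra τ Θ) :
    ∃ E, HasPolynomialGrowth (fun t p => 0 ≤ F t p) E := by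
  obtain ⟨ι, _, u, v, h⟩ := hF
  simp only [h]
  exact ⟨_, hasPolynomialGrowth_nonneg_sum u v⟩

end Growth

/-! ### From polynomial growth to covering numbers. -/

section Entropy

variable {Ω : Type*} [MeasurableSpace Ω]

/-- The expected number of sets `A i` containing a random point is at least `q * I.card`, and some
point does at least as well as the mean. -/
lemma exists_mem_of_le_measureReal {ι : Type*} (P : Measure Ω) [IsProbabilityMeasure P]
    (I : Finset ι) {A : ι → Set Ω} (hA : ∀ i ∈ I, MeasurableSet (A i)) {q : ℝ}
    (hq : ∀ i ∈ I, q ≤ P.real (A i)) :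
    ∃ y, q * I.card ≤ ∑ i ∈ I, (A i).indicator (fun _ => (1 : ℝ)) y := by
  have hint : ∀ i ∈ I, Integrable ((A i).indicator (fun _ => (1 : ℝ))) P := fun i hi =>
    (integrable_const _).indicator (hA i hi)
  obtain ⟨y, hy⟩ := exists_integral_le (integrable_finsetSum I hint)
  refine ⟨y, le_trans ?_ hy⟩
  rw [integral_finsetSum _ hint, mul_comm, ← nsmul_eq_mul]
  refine Finset.card_nsmul_le_sum _ _ _ fun i hi => ?_
  rw [integral_indicator_const _ (hA i hi), smul_eq_mul, mul_one]
  exact hq i hi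

open scoped Classical in
/-- Greedy choice of `m` points: all but a proportion `(1 - q) ^ m` of the sets `A i`, each of
probability at least `q`, contain one of them. -/
lemma exists_finset_card_filter_le {ι : Type*} (P : Measure Ω) [IsProbabilityMeasure P]
    (I : Finset ι) {A : ι → Set Ω} (hA : ∀ i ∈ I, MeasurableSet (A i)) {q : ℝ} (hq1 : q ≤ 1)
    (hq : ∀ i ∈ I, q ≤ P.real (A i)) (m : ℕ) :
    ∃ Y : Finset Ω, Y.card ≤ m ∧
      ((I.filter fun i => ∀ y ∈ Y, y ∉ A i).card : ℝ) ≤ (1 - q) ^ m * I.card := by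
  induction m with
  | zero => exact ⟨∅, by simp⟩
  | succ m ih =>
    obtain ⟨Y, hYm, hY⟩ := ih
    set J := I.filter fun i => ∀ y ∈ Y, y ∉ A i with hJ
    have hJI : ∀ i ∈ J, i ∈ I := fun i hi => (Finset.mem_filter.1 hi).1
    -- The next point lies in at least a proportion `q` of the sets still missed.
    obtain ⟨y, hy⟩ := exists_mem_of_le_measureReal P J (fun i hi => hA i (hJI i hi))
      (fun i hi => hq i (hJI i hi))
    refine ⟨insert y Y, (Finset.card_insert_le _ _).trans (by omega), ?_⟩
    have h1 : (I.filter fun i => ∀ z ∈ insert y Y, z ∉ A i) = J.filter fun i => y ∉ A i := by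
      ext i
      simp [hJ]
      tauto
    have h2 : ∑ i ∈ J, (A i).indicator (fun _ => (1 : ℝ)) y = (J.filter fun i => y ∈ A i).card := by
      simp [Set.indicator_apply, Finset.sum_boole]
    have h3 := Finset.card_filter_add_card_filter_not (s := J) (fun i => y ∈ A i)
    have h4 : ((J.filter fun i => y ∈ A i).card : ℝ) + (J.filter fun i => y ∉ A i).card = J.card := by
      exact_mod_cast h3
    rw [h1, pow_succ]
    have h5 := mul_le_mul_of_nonneg_left hY (sub_nonneg.2 hq1)
    linarith

/-- Splitting `∫ f²` at `|f| = ρ / 2` gives `ρ² ≤ ρ² / 4 + 4 M² P(|f| > ρ / 2)`, which is slightly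
stronger than needed. -/
lemma le_measureReal_of_le_eLpNorm {P : Measure Ω} [IsProbabilityMeasure P] {f : Ω → ℝ}
    (hf : Measurable f) {M ρ : ℝ} (hM : 0 < M) (hρ : 0 < ρ) (hfM : ∀ y, |f y| ≤ 2 * M)
    (h : ENNReal.ofReal ρ ≤ eLpNorm f 2 P) :
    (ρ / M) ^ 2 / 8 ≤ P.real {y | ρ / 2 < |f y|} := by
  have hA : MeasurableSet {y | ρ / 2 < |f y|} := measurableSet_lt measurable_const hf.norm
  have hmem : MemLp f 2 P := MemLp.of_bound hf.aestronglyMeasurable (2 * M)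
    (Filter.Eventually.of_forall hfM)
  have hint : Integrable (fun y => f y ^ 2) P := hmem.integrable_sq
  have h1 : ρ ^ 2 ≤ ∫ y, f y ^ 2 ∂P := by
    rw [hmem.eLpNorm_eq_integral_rpow_norm (by norm_num) (by norm_num),
      ENNReal.ofReal_le_ofReal_iff (by positivity)] at h
    simp only [ENNReal.toReal_ofNat, Real.rpow_two, Real.norm_eq_abs, sq_abs] at h
    rw [← one_div, ← Real.sqrt_eq_rpow] at h
    exact (Real.le_sqrt hρ.le (integral_nonneg fun y => sq_nonneg _)).1 h
  have h2 : ∫ y, f y ^ 2 ∂P ≤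
      ∫ y, (ρ ^ 2 / 4 + {y | ρ / 2 < |f y|}.indicator (fun _ => 4 * M ^ 2) y) ∂P := by
    refine integral_mono hint ((integrable_const _).add ((integrable_const _).indicator hA))
      fun y => ?_
    simp only [Set.indicator_apply, Set.mem_ofPred_eq]
    split_ifs with hy
    · have := pow_le_pow_left₀ (abs_nonneg _) (hfM y) 2
      rw [sq_abs] at this
      nlinarith [sq_nonneg ρ]
    · have := pow_le_pow_left₀ (abs_nonneg _) (not_lt.1 hy) 2
      rw [sq_abs] at this
      linarith
  rw [integral_add (integrable_const _) ((integrable_const _).indicator hA),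
    integral_indicator_const _ hA] at h2
  simp only [integral_const, probReal_univ, smul_eq_mul, one_mul] at h2
  have h3 : 0 < M ^ 2 := by positivity
  rw [div_pow, div_div, div_le_iff₀ (by positivity)]
  nlinarith [sq_nonneg ρ]

/-- The highest multiple of `ρ / 2` not above `a` is less than `ρ / 2` below it, hence above `b`. -/
lemma exists_int_mul_mem_Ioc {a b ρ M : ℝ} (hρ : 0 < ρ) (ha : |a| ≤ M) (hb : |b| ≤ M)
    (h : ρ / 2 < a - b) :
    ∃ l ∈ Finset.Icc (-⌊2 * M / ρ⌋) ⌊2 * M / ρ⌋, b < l * (ρ / 2) ∧ l * (ρ / 2) ≤ a := by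
  have h1 : (⌊a / (ρ / 2)⌋ : ℝ) * (ρ / 2) ≤ a :=
    (le_div_iff₀ (by positivity)).1 (Int.floor_le _)
  have h2 : a < (⌊a / (ρ / 2)⌋ + 1 : ℝ) * (ρ / 2) :=
    (div_lt_iff₀ (by positivity)).1 (Int.lt_floor_add_one _)
  refine ⟨⌊a / (ρ / 2)⌋, Finset.mem_Icc.2 ⟨?_, ?_⟩, by linarith, h1⟩
  · rw [neg_le, Int.le_floor, le_div_iff₀ hρ]
    push_cast
    linarith [(abs_le.1 hb).1]
  · rw [Int.le_floor, le_div_iff₀ hρ]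
    linarith [(abs_le.1 ha).2]

/-- The subgraph relation `s ≤ g y` of a class `G` of functions. -/
def SubgraphRel (G : Set (Ω → ℝ)) (t : Ω × ℝ) (g : G) : Prop := t.2 ≤ g.1 t.1

lemma card_le_of_pairwise_eLpNorm {P : Measure Ω} [IsProbabilityMeasure P] {G : Set (Ω → ℝ)}
    {E : ℕ} (hG : HasPolynomialGrowth (SubgraphRel G) E) (hmeas : ∀ g ∈ G, Measurable g)
    {M ρ : ℝ} (hM : ∀ g ∈ G, ∀ y, |g y| ≤ M) (hρ : 0 < ρ) (hρM : ρ < M)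
    {C : Finset (Ω → ℝ)} (hCG : (C : Set (Ω → ℝ)) ⊆ G)
    (hsep : (C : Set (Ω → ℝ)).Pairwise fun f g => ENNReal.ofReal ρ ≤ eLpNorm (f - g) 2 P)
    {m : ℕ} (hm : (1 - (ρ / M) ^ 2 / 8) ^ m * (C.card : ℝ) ^ 2 < 1) :
    (C.card : ℝ) ≤ (m * (4 / (ρ / M) + 1) + 1) ^ E := by
  classical
  have hM0 : 0 < M := hρ.trans hρM
  have hq1 : (ρ / M) ^ 2 / 8 ≤ 1 := by
    have : (ρ / M) ^ 2 ≤ 1 := pow_le_one₀ (by positivity) ((div_le_one hM0).2 hρM.le)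
    linarith
  set A : (Ω → ℝ) × (Ω → ℝ) → Set Ω := fun i => {y | ρ / 2 < |(i.1 - i.2) y|} with hAdef
  have hI : ∀ i ∈ C.offDiag, i.1 ∈ G ∧ i.2 ∈ G ∧
      ENNReal.ofReal ρ ≤ eLpNorm (i.1 - i.2) 2 P := fun i hi => by
    obtain ⟨h1, h2, h3⟩ := Finset.mem_offDiag.1 hi
    exact ⟨hCG h1, hCG h2, hsep h1 h2 h3⟩
  obtain ⟨Y, hYm, hY⟩ := exists_finset_card_filter_le P C.offDiag (A := A)
    (fun i hi => measurableSet_lt measurable_const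
      ((hmeas _ (hI i hi).1).sub (hmeas _ (hI i hi).2.1)).norm) hq1
    (fun i hi => le_measureReal_of_le_eLpNorm ((hmeas _ (hI i hi).1).sub (hmeas _ (hI i hi).2.1))
      hM0 hρ (fun y => (abs_sub _ _).trans (by
        linarith [hM _ (hI i hi).1 y, hM _ (hI i hi).2.1 y])) (hI i hi).2.2) m
  have hoff : (C.offDiag.card : ℝ) ≤ (C.card : ℝ) ^ 2 := by
    rw [Finset.offDiag_card, sq]
    exact_mod_cast Nat.sub_le _ _
  -- Fewer than one pair remains unseparated by `Y`, hence none.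
  have hempty : (C.offDiag.filter fun i => ∀ y ∈ Y, y ∉ A i) = ∅ := by
    rw [← Finset.card_eq_zero, ← Nat.lt_one_iff]
    have : (1 - (ρ / M) ^ 2 / 8) ^ m * C.offDiag.card < 1 :=
      (mul_le_mul_of_nonneg_left hoff (pow_nonneg (sub_nonneg.2 hq1) m)).trans_lt hm
    exact_mod_cast hY.trans_lt this
  have hpt : ∀ f ∈ C, ∀ g ∈ C, f ≠ g → ∃ y ∈ Y, ρ / 2 < |f y - g y| := by
    intro f hf g hg hfg
    have h := Finset.filter_eq_empty_iff.1 hempty (Finset.mem_offDiag.2 ⟨hf, hg, hfg⟩ :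
      (f, g) ∈ C.offDiag)
    push Not at h
    simpa [hAdef] using h
  set S : Finset ℝ := (Finset.Icc (-⌊2 * M / ρ⌋) ⌊2 * M / ρ⌋).image
    fun l : ℤ => (l : ℝ) * (ρ / 2)
  set T := Y ×ˢ S with hT
  -- Where `f` exceeds `g` by more than `ρ / 2`, a grid level lies between them and belongs to the
  -- subgraph of `f` only.
  have hlevel : ∀ f ∈ C, ∀ g ∈ C, ∀ y ∈ Y, ρ / 2 < f y - g y →
      (T.filter fun t => t.2 ≤ f t.1) ≠ T.filter fun t => t.2 ≤ g t.1 := by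
    intro f hf g hg y hy h heq
    obtain ⟨l, hl, hl1, hl2⟩ := exists_int_mul_mem_Ioc hρ (hM f (hCG hf) y) (hM g (hCG hg) y) h
    have hmem : (y, (l : ℝ) * (ρ / 2)) ∈ T.filter fun t => t.2 ≤ f t.1 :=
      Finset.mem_filter.2 ⟨Finset.mem_product.2 ⟨hy, Finset.mem_image.2 ⟨l, hl, rfl⟩⟩, hl2⟩
    rw [heq] at hmem
    exact hl1.not_ge (Finset.mem_filter.1 hmem).2
  have hcard : C.card ≤ (tracePatterns (SubgraphRel G) T).card := by
    refine Finset.card_le_card_of_injOn (fun f => T.filter fun t => t.2 ≤ f t.1)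
      (fun f hf => mem_tracePatterns.2 ⟨⟨f, hCG hf⟩, rfl⟩) fun f hf g hg hfg => ?_
    by_contra hne
    obtain ⟨y, hy, hlt⟩ := hpt f hf g hg hne
    rcases lt_abs.1 hlt with h | h
    · exact hlevel f hf g hg y hy h hfg
    · exact hlevel g hg f hf y hy (by linarith) hfg.symm
  have hScard : (S.card : ℝ) ≤ 4 / (ρ / M) + 1 := by
    have h0 : 0 ≤ ⌊2 * M / ρ⌋ := Int.floor_nonneg.2 (by positivity)
    have h1 : (S.card : ℝ) ≤ ((Finset.Icc (-⌊2 * M / ρ⌋) ⌊2 * M / ρ⌋).card : ℝ) := by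
      exact_mod_cast Finset.card_image_le
    have h2 : ((Finset.Icc (-⌊2 * M / ρ⌋) ⌊2 * M / ρ⌋).card : ℤ) = 2 * ⌊2 * M / ρ⌋ + 1 := by
      rw [Int.card_Icc, Int.toNat_of_nonneg (by omega)]
      ring
    have h3 : ((Finset.Icc (-⌊2 * M / ρ⌋) ⌊2 * M / ρ⌋).card : ℝ) = 2 * ⌊2 * M / ρ⌋ + 1 := by
      exact_mod_cast h2
    have h4 := Int.floor_le (2 * M / ρ)
    have h5 : 4 / (ρ / M) = 2 * (2 * M / ρ) := by
      field_simp
      norm_num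
    linarith
  have hTcard : (T.card : ℝ) ≤ m * (4 / (ρ / M) + 1) := by
    rw [hT, Finset.card_product]
    push_cast
    exact mul_le_mul (by exact_mod_cast hYm) hScard (by positivity) (by positivity)
  calc (C.card : ℝ) ≤ ((T.card + 1) ^ E : ℕ) := by exact_mod_cast hcard.trans (hG T)
    _ = ((T.card : ℝ) + 1) ^ E := by push_cast; rfl
    _ ≤ _ := by gcongr

/-- A bound of `n` by a power of the number `m ∼ log n / r ^ 2` of points needed to separate `n`
functions forces a polynomial bound on `n` in `1 / r`. -/
lemma le_pow_of_forall_pow_mul_sq_lt_one {n E : ℕ} (hE : 0 < E) {r : ℝ} (hr : 0 < r)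
    (hr1 : r < 1)
    (h : ∀ m : ℕ, (1 - r ^ 2 / 8) ^ m * (n : ℝ) ^ 2 < 1 → (n : ℝ) ≤ (m * (4 / r + 1) + 1) ^ E) :
    (n : ℝ) ≤ ((160 * E + 6) / r) ^ (6 * E) := by
  have hK : (1 : ℝ) ≤ (160 * E + 6) / r := by
    rw [one_le_div hr]
    nlinarith [Nat.cast_nonneg (α := ℝ) E]
  rcases Nat.eq_zero_or_pos n with rfl | hn
  · simp only [Nat.cast_zero]
    positivity
  have hn1 : (1 : ℝ) ≤ n := by exact_mod_cast hn
  have hE0 : (0 : ℝ) < E := by exact_mod_cast hE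
  have hlog : 0 ≤ Real.log n := Real.log_nonneg hn1
  -- Since `log n ≤ 2 E z`, the assumed bound becomes `n ≤ (const * z) ^ E` with `z ^ E = √n`; one
  -- factor `√n` cancels.
  set z : ℝ := (n : ℝ) ^ (1 / (2 * E) : ℝ) with hz
  have hz1 : 1 ≤ z := Real.one_le_rpow hn1 (by positivity)
  have hzn : z ^ (2 * E) = n := by
    rw [hz, ← Real.rpow_natCast, ← Real.rpow_mul (by positivity)]
    push_cast
    rw [one_div_mul_cancel (by positivity), Real.rpow_one]
  have hlogz : Real.log n ≤ 2 * E * z := by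
    have h1 := Real.log_le_rpow_div (x := n) (ε := 1 / (2 * E)) (by positivity) (by positivity)
    rw [div_div_eq_mul_div, div_one] at h1
    linarith
  -- Chosen so that `m r² / 8 > 2 log n`, which makes `(1 - r² / 8) ^ m * n²` less than `1`.
  set m := ⌊16 * Real.log n / r ^ 2⌋₊ + 1 with hm
  have hm1 : 16 * Real.log n / r ^ 2 < m := by
    rw [hm]
    push_cast
    exact Nat.lt_floor_add_one _
  have hm2 : (m : ℝ) ≤ 16 * Real.log n / r ^ 2 + 1 := by
    rw [hm]
    push_cast
    gcongr
    exact Nat.floor_le (by positivity)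
  have hr2 : r ^ 2 ≤ 1 := pow_le_one₀ hr.le hr1.le
  have hr3 : r ^ 3 ≤ 1 := pow_le_one₀ hr.le hr1.le
  have hn_le := h m (by
    have h1 : (1 - r ^ 2 / 8) ^ m ≤ Real.exp (-(m * (r ^ 2 / 8))) := by
      rw [← mul_neg, Real.exp_nat_mul]
      exact pow_le_pow_left₀ (by linarith) (Real.one_sub_le_exp_neg _) m
    have h2 : (n : ℝ) ^ 2 = Real.exp (2 * Real.log n) := by
      rw [two_mul, Real.exp_add, Real.exp_log (by positivity), sq]
    rw [h2]
    refine (mul_le_mul_of_nonneg_right h1 (Real.exp_pos _).le).trans_lt ?_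
    rw [← Real.exp_add, Real.exp_lt_one_iff]
    rw [div_lt_iff₀ (by positivity)] at hm1
    linarith)
  -- The constant is `5 * (32 E + 1) + 1`.
  have hbase : (m : ℝ) * (4 / r + 1) + 1 ≤ (160 * E + 6) / r ^ 3 * z := by
    have h1 : (m : ℝ) ≤ (32 * E + 1) * z / r ^ 2 := by
      refine hm2.trans ?_
      rw [le_div_iff₀ (by positivity), add_mul, div_mul_cancel₀ _ (by positivity)]
      linarith
    have h2 : 4 / r + 1 ≤ 5 / r := by
      rw [le_div_iff₀ hr, add_mul, div_mul_cancel₀ _ hr.ne']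
      linarith
    have h3 : (1 : ℝ) ≤ z / r ^ 3 := by
      rw [one_le_div (by positivity)]
      linarith
    calc (m : ℝ) * (4 / r + 1) + 1 ≤ (32 * E + 1) * z / r ^ 2 * (5 / r) + z / r ^ 3 :=
          add_le_add (mul_le_mul h1 h2 (by positivity) (by positivity)) h3
      _ = (160 * E + 6) / r ^ 3 * z := by
          field_simp
          ring
  have hz_le : z ^ E ≤ ((160 * E + 6) / r ^ 3) ^ E := by
    have h1 : z ^ E * z ^ E ≤ ((160 * E + 6) / r ^ 3) ^ E * z ^ E := by
      rw [← pow_add, ← two_mul, hzn, ← mul_pow]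
      exact hn_le.trans (pow_le_pow_left₀ (by positivity) hbase E)
    exact le_of_mul_le_mul_right h1 (by positivity)
  calc (n : ℝ) = (z ^ E) ^ 2 := by rw [← hzn, ← pow_mul, mul_comm]
    _ ≤ (((160 * E + 6) / r ^ 3) ^ E) ^ 2 := by gcongr
    _ = ((160 * E + 6) / r ^ 3) ^ (2 * E) := by rw [← pow_mul, mul_comm E]
    _ ≤ (((160 * E + 6) / r) ^ 3) ^ (2 * E) := by
        gcongr
        rw [div_pow]
        gcongr
        exact le_self_pow₀ (by linarith) (by norm_num)
    _ = ((160 * E + 6) / r) ^ (6 * E) := by rw [← pow_mul]; ring_nf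

variable {d : ℕ}

/-- A `ρ`-separated subset of maximal cardinality covers `G`: a function at distance at least `ρ`
from all its members could be added. -/
lemma coveringNumberL2_le_of_forall_card_le {P : Measure (EuclideanSpace ℝ (Fin d))}
    {G : Set (EuclideanSpace ℝ (Fin d) → ℝ)} {ρ B : ℝ} (hρ : 0 < ρ)
    (h : ∀ C : Finset (EuclideanSpace ℝ (Fin d) → ℝ),
      (C : Set (EuclideanSpace ℝ (Fin d) → ℝ)) ⊆ G →
      (C : Set (EuclideanSpace ℝ (Fin d) → ℝ)).Pairwise
        (fun f g => ENNReal.ofReal ρ ≤ eLpNorm (f - g) 2 P) → (C.card : ℝ) ≤ B) :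
    (coveringNumberL2 P G ρ : ℝ≥0∞) ≤ ENNReal.ofReal B := by
  classical
  set N : Set ℕ := {n | ∃ C : Finset (EuclideanSpace ℝ (Fin d) → ℝ),
    (C : Set (EuclideanSpace ℝ (Fin d) → ℝ)) ⊆ G ∧
    (C : Set (EuclideanSpace ℝ (Fin d) → ℝ)).Pairwise
      (fun f g => ENNReal.ofReal ρ ≤ eLpNorm (f - g) 2 P) ∧ C.card = n} with hN
  have hbdd : BddAbove N := by
    refine ⟨⌊B⌋₊, ?_⟩
    rintro n ⟨C, h1, h2, rfl⟩
    exact Nat.le_floor (h C h1 h2)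
  obtain ⟨C, hCG, hsep, hC⟩ := Nat.sSup_mem (s := N) ⟨0, ∅, by simp⟩ hbdd
  have hcov : ∀ g ∈ G, ∃ c ∈ (C : Set (EuclideanSpace ℝ (Fin d) → ℝ)),
      eLpNorm (g - c) 2 P < ENNReal.ofReal ρ := by
    intro g hg
    by_contra! hfar
    have hgC : g ∉ C := fun hgC => by
      have := hfar g hgC
      simp [hρ.not_ge] at this
    have hmem : (insert g C).card ∈ N := by
      refine ⟨insert g C, ?_, ?_, rfl⟩
      · rw [Finset.coe_insert]
        exact Set.insert_subset hg hCG
      · rw [Finset.coe_insert]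
        refine hsep.insert fun c hc _ => ⟨hfar c hc, ?_⟩
        rw [eLpNorm_sub_comm]
        exact hfar c hc
    have := le_csSup hbdd hmem
    rw [Finset.card_insert_of_notMem hgC] at this
    omega
  have hle : coveringNumberL2 P G ρ ≤ (C.card : ℕ∞) := by
    refine (iInf₂_le_of_le (C : Set _) hCG (iInf_le_of_le hcov ?_))
    rw [Set.encard_coe_eq_coe_finsetCard]
  calc (coveringNumberL2 P G ρ : ℝ≥0∞) ≤ ((C.card : ℕ∞) : ℝ≥0∞) :=
        ENat.toENNReal_mono hle
    _ = ENNReal.ofReal C.card := by simp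
    _ ≤ ENNReal.ofReal B := ENNReal.ofReal_le_ofReal (h C hCG hsep)

/-- A bounded class of measurable functions whose subgraphs have polynomial growth is a
VC-class. -/
lemma isUniformlyBoundedVCClass_of_hasPolynomialGrowth
    {G : Set (EuclideanSpace ℝ (Fin d) → ℝ)} {E : ℕ} (hE : 0 < E)
    (hmeas : ∀ g ∈ G, Measurable g) (hG : HasPolynomialGrowth (SubgraphRel G) E)
    (hbdd : classSupNorm G < ⊤) :
    IsUniformlyBoundedVCClass G (6 * E) (160 * E + 6) where
  measurable := hmeas
  dimension_pos := by positivity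
  characteristic_pos := by positivity
  supNorm_lt_top := hbdd
  covering P _ ρ hρ hρM := by
    set M := (classSupNorm G).toReal with hM
    have hM0 : 0 < M := hρ.trans hρM
    have hGM : ∀ g ∈ G, ∀ y, |g y| ≤ M := fun g hg y => by
      have h1 : ‖g y‖ₑ ≤ classSupNorm G := by
        unfold classSupNorm
        exact le_iSup₂_of_le g hg (le_iSup (fun y => ‖g y‖ₑ) y)
      have h2 := ENNReal.toReal_mono hbdd.ne h1
      simpa using h2
    refine coveringNumberL2_le_of_forall_card_le hρ fun C hCG hsep => ?_
    have h := le_pow_of_forall_pow_mul_sq_lt_one hE (div_pos hρ hM0) ((div_lt_one hM0).2 hρM)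
      fun m hm => card_le_of_pairwise_eLpNorm hG hmeas hGM hρ hρM hCG hsep hm
    rw [div_div_eq_mul_div] at h
    refine h.trans_eq ?_
    rw [← Real.rpow_natCast]
    push_cast
    rfl

end Entropy

/-! ### Subgraphs of the translated and dilated kernels. -/

section KernelClass

variable {d : ℕ} (α : ℝ)

lemma exists_hasPolynomialGrowth_legendreKernel (d : ℕ) (α : ℝ) :
    ∃ E : ℕ, HasPolynomialGrowth
      (fun (t : EuclideanSpace ℝ (Fin d) × ℝ) (p : EuclideanSpace ℝ (Fin d) × ℝ) =>
        t.2 ≤ legendreKernel d α (p.2⁻¹ • (t.1 - p.1))) E := by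
  classical
  set q := legendreReproducingPoly ⌈α⌉₊ with hq
  set F : Fin d → EuclideanSpace ℝ (Fin d) × ℝ → EuclideanSpace ℝ (Fin d) × ℝ → ℝ :=
    fun i t p => p.2⁻¹ * (t.1 i - p.1 i) with hF
  have hFmem : ∀ i, F i ∈ finiteRankSubalgebra _ _ := fun i =>
    mul_mem (right_mem_finiteRankSubalgebra fun p : EuclideanSpace ℝ (Fin d) × ℝ => p.2⁻¹)
      (sub_mem
        (left_mem_finiteRankSubalgebra fun t : EuclideanSpace ℝ (Fin d) × ℝ => t.1 i)
        (right_mem_finiteRankSubalgebra fun p : EuclideanSpace ℝ (Fin d) × ℝ => p.1 i))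
  -- The index `some i` encodes that the `i`-th rescaled coordinate lies in `[-1, 1]`; `none`
  -- compares the level with the product of polynomials.
  set Q : Option (Fin d) → EuclideanSpace ℝ (Fin d) × ℝ → EuclideanSpace ℝ (Fin d) × ℝ → ℝ :=
    fun j => j.elim ((∏ i, fun t p => q.eval (F i t p)) - fun t _ => t.2)
      (fun i => 1 - F i ^ 2) with hQ
  have hQmem : ∀ j, Q j ∈ finiteRankSubalgebra _ _ := by
    rintro (_ | i)
    · exact sub_mem (prod_mem fun i _ => polynomial_eval_mem_finiteRankSubalgebra (hFmem i) q)
        (left_mem_finiteRankSubalgebra _)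
    · exact sub_mem (one_mem _) (pow_mem (hFmem i) 2)
  choose E hE using fun j => exists_hasPolynomialGrowth_nonneg (hQmem j)
  refine ⟨_, HasPolynomialGrowth.of_forall_iff hE
    -- Outside the cube the kernel is `0`, so the subgraph condition reduces to `t.2 ≤ 0`, free of
    -- the parameter.
    (fun t b => if ∀ i, b (some i) then b none else t.2 ≤ 0) fun t p => ?_⟩
  have hi : ∀ i, 0 ≤ Q (some i) t p ↔ F i t p ∈ Set.Icc (-1 : ℝ) 1 := fun i => by
    simp only [hQ, Option.elim_some, Pi.sub_apply, Pi.one_apply, Pi.pow_apply, sub_nonneg,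
      sq_le_one_iff_abs_le_one, abs_le, Set.mem_Icc]
  have hk : legendreKernel d α (p.2⁻¹ • (t.1 - p.1)) =
      ∏ i, (Set.Icc (-1 : ℝ) 1).indicator (fun s => q.eval s) (F i t p) := by
    simp only [legendreKernel, legendreGamma_eq_indicator, PiLp.smul_apply, PiLp.sub_apply,
      smul_eq_mul, hF, hq]
  rw [hk]
  simp only [hi]
  split_ifs with hall
  · simp [hQ, Set.indicator_of_mem (hall _)]
  · push Not at hall
    obtain ⟨i, hi⟩ := hall
    rw [Finset.prod_eq_zero (Finset.mem_univ i) (Set.indicator_of_notMem hi _)]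

lemma classSupNorm_kernelClass_lt_top (X : Set (EuclideanSpace ℝ (Fin d))) (H : Set ℝ) :
    classSupNorm (kernelClass (legendreKernel d α) X H) < ⊤ := by
  obtain ⟨M, hM⟩ := exists_abs_legendreKernel_le (d := d) α
  refine lt_of_le_of_lt (b := ENNReal.ofReal M) ?_ ENNReal.ofReal_lt_top
  refine iSup₂_le fun g hg => iSup_le fun y => ?_
  obtain ⟨x, -, h, -, rfl⟩ := hg
  rw [← ofReal_norm]
  exact ENNReal.ofReal_le_ofReal (hM _)

lemma exists_satisfiesK2_legendreKernel (d : ℕ) (α : ℝ) :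
    ∃ ν Λ : ℝ, ∀ (X : Set (EuclideanSpace ℝ (Fin d))) (H : Set ℝ),
      SatisfiesK2 (legendreKernel d α) X H ν Λ := by
  obtain ⟨E, hE⟩ := exists_hasPolynomialGrowth_legendreKernel d α
  -- The exponent comes from the family of all `(x, h)`, so it serves every `X` and `H`; `E + 1`
  -- makes it positive.
  refine ⟨6 * (E + 1 : ℕ), 160 * (E + 1 : ℕ) + 6, fun X H =>
    ⟨memLp_two_legendreKernel α, exists_abs_legendreKernel_le α,
      isUniformlyBoundedVCClass_of_hasPolynomialGrowth E.succ_pos ?_ ?_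
        (classSupNorm_kernelClass_lt_top α X H)⟩⟩
  · rintro g ⟨x, -, h, -, rfl⟩
    exact (measurable_legendreKernel α).comp (by fun_prop)
  · refine HasPolynomialGrowth.comap (fun T => (hE T).trans ?_) ?_
    · exact Nat.pow_le_pow_right (Nat.succ_pos _) E.le_succ
    · rintro ⟨g, x, -, h, -, rfl⟩
      exact ⟨(x, h), fun t => Iff.rfl⟩

end KernelClass

theorem proposition1 (d : ℕ) (α : ℝ) (hα : 0 < α) :
    SatisfiesK1 α (legendreKernel d α) ∧
    ∃ ν Λ : ℝ, ∀ X : Set (EuclideanSpace ℝ (Fin d)),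
      (∀ h : ℝ, 0 < h → SatisfiesK2 (legendreKernel d α) X {h} ν Λ) ∧
      SatisfiesK2 (legendreKernel d α) X (Set.Ioi 0) ν Λ := by
  obtain ⟨ν, Λ, h⟩ := exists_satisfiesK2_legendreKernel d α
  exact ⟨satisfiesK1_legendreKernel hα, ν, Λ, fun X => ⟨fun _ _ => h X _, h X _⟩⟩
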